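/- A transmitter with $N_t$ antennas serves receivers $1,\dots,K$ over known channels (row vectors) $h_1,\dots,h_K\in\mathbb C^{1\times N_t}$. Let $P\in\mathbb R$ be the power budget, $\tau_{ms}\ge 0$ the required multicast rate and $\tau'=2^{\tau_{ms}}-1$. Consider the problem of maximizing $$\log_2\frac{1+h_1(Q_c+Q_a)h_1^H}{\alpha\,(1+h_1Q_ah_1^H)}$$ over real $\alpha\ge 1$ and Hermitian positive semidefinite $N_t\times N_t$ matrices $Q_0,Q_a,Q_c$ (the transmit covariances of the multicast message, of the artificial noise and of the confidential message for receiver $1$), subject to $$\log_2\Bigl(1+\frac{h_kQ_ch_k^H}{1+h_kQ_ah_k^H}\Bigr)\le\log_2\alpha\qquad(k=2,\dots,K),$$ $$h_kQ_0h_k^H-\tau' h_k(Q_a+Q_c)h_k^H-\tau'\ge 0\qquad(k=1,\dots,K),$$ $$\operatorname{Tr}(Q_0+Q_a+Q_c)\le P.$$ Assume that the problem is nontrivial, i.e. that some feasible point has a positive objective value (a positive secrecy rate is achievable). Then the problem has an optimal solution, and in every optimal solution $(Q_0^*,Q_a^*,Q_c^*,\alpha^*)$ the confidential covariance $Q_c^*$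 has rank one. In other words, transmit beamforming is optimal for the confidential message. -/

import Mathlib

open scoped Matrix ComplexOrder

noncomputable section

namespace SecrecyRate

/-- The received power `h Q hᴴ` of a signal with transmit covariance `Q` over the channel `h`,
a row vector in `ℂ^{1 × Nt}`. (For Hermitian `Q` this number is real, so the real part
loses nothing.) -/
def rxPower {Nt : ℕ} (h : Fin Nt → ℂ) (Q : Matrix (Fin Nt) (Fin Nt) ℂ) : ℝ :=
  (h ⬝ᵥ (Q *ᵥ star h)).re

/-- The optimization variables: the covariances of the multicast message (`Q0`), of the
artificial noise (`Qa`) and of the confidential message (`Qc`), and the slack variable `α`. -/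
structure Design (Nt : ℕ) where
  Q0 : Matrix (Fin Nt) (Fin Nt) ℂ
  Qa : Matrix (Fin Nt) (Fin Nt) ℂ
  Qc : Matrix (Fin Nt) (Fin Nt) ℂ
  α : ℝ

/-- The threshold `τ' = 2 ^ τms - 1` that belongs to the multicast rate `τms` (in bits). -/
def tauPrime (τms : ℝ) : ℝ := (2 : ℝ) ^ τms - 1

/-- The constraints of the secrecy rate maximization problem with multicast rate requirement
`τms` and power budget `P`. The channels are `h k`, `k : Fin K`; receiver `0` is the one that
ordered the confidential message, all others are eavesdroppers. -/
structure IsFeasible {K Nt : ℕ} [NeZero K] (h : Fin K → Fin Nt → ℂ) (P τms : ℝ)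
    (x : Design Nt) : Prop where
  one_le_alpha : 1 ≤ x.α
  eavesdropper : ∀ k : Fin K, k ≠ 0 →
    Real.logb 2 (1 + rxPower (h k) x.Qc / (1 + rxPower (h k) x.Qa)) ≤ Real.logb 2 x.α
  multicast : ∀ k : Fin K,
    0 ≤ rxPower (h k) x.Q0 - tauPrime τms * rxPower (h k) (x.Qa + x.Qc) - tauPrime τms
  power : (x.Q0 + x.Qa + x.Qc).trace.re ≤ P
  posSemidef_Q0 : x.Q0.PosSemidef
  posSemidef_Qa : x.Qa.PosSemidef
  posSemidef_Qc : x.Qc.PosSemidef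

/-- The objective, a secrecy rate of receiver `0` (in bits). -/
def objective {K Nt : ℕ} [NeZero K] (h : Fin K → Fin Nt → ℂ) (x : Design Nt) : ℝ :=
  Real.logb 2 ((1 + rxPower (h 0) (x.Qc + x.Qa)) / (x.α * (1 + rxPower (h 0) x.Qa)))

/-- `x` is a (globally) optimal solution of the problem. -/
def IsOptimal {K Nt : ℕ} [NeZero K] (h : Fin K → Fin Nt → ℂ) (P τms : ℝ)
    (x : Design Nt) : Prop :=
  IsFeasible h P τms x ∧ ∀ y : Design Nt, IsFeasible h P τms y → objective h y ≤ objective h x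

end SecrecyRate

end

namespace SecrecyRate

open Matrix

section RxPower

variable {n : ℕ} (h : Fin n → ℂ)

/-! Existence: a positive objective forces `α - 1 < h₁ Qc h₁ᴴ`, which the power budget bounds, so
the search reduces to a compact set. Rank one: `beam` keeps the power at receiver 1 and lies below
`Qc` in the Loewner order (`posSemidef_sub_beam`), so replacing `Qc` by it keeps every constraint
and the objective. If `Qc` differs from its beam, the trace drops strictly, and the freed power can
be spent on a strict gain (`exists_objective_lt_of_power_lt`), contradicting optimality. -/

lemma rxPower_add (A B : Matrix (Fin n) (Fin n) ℂ) :
    rxPower h (A + B) = rxPower h A + rxPower h B := by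
  simp [rxPower, add_mulVec, dotProduct_add]

lemma rxPower_sub (A B : Matrix (Fin n) (Fin n) ℂ) :
    rxPower h (A - B) = rxPower h A - rxPower h B := by
  simp [rxPower, sub_mulVec, dotProduct_sub]

lemma rxPower_smul (t : ℝ) (A : Matrix (Fin n) (Fin n) ℂ) :
    rxPower h (t • A) = t * rxPower h A := by
  simp [rxPower, smul_mulVec, dotProduct_smul]

lemma rxPower_nonneg {A : Matrix (Fin n) (Fin n) ℂ} (hA : A.PosSemidef) :
    0 ≤ rxPower h A := by
  have := hA.re_dotProduct_nonneg (star h)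
  simpa [rxPower] using this

lemma ofReal_rxPower {A : Matrix (Fin n) (Fin n) ℂ} (hA : A.PosSemidef) :
    (rxPower h A : ℂ) = h ⬝ᵥ (A *ᵥ star h) := by
  have := hA.dotProduct_mulVec_nonneg (star h)
  rw [star_star] at this
  exact (Complex.eq_re_of_ofReal_le (r := 0) (by simpa using this)).symm

lemma continuous_rxPower : Continuous (rxPower h) := by
  unfold rxPower
  fun_prop

end RxPower

/-! ### Beams and compactness in the positive semidefinite cone -/

section Matrices

variable {n : ℕ}

/-- The rank-one matrix `Q hᴴ h Q / (h Q hᴴ)`, which delivers the same power as `Q` over `h`. -/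
noncomputable def beam (h : Fin n → ℂ) (Q : Matrix (Fin n) (Fin n) ℂ) : Matrix (Fin n) (Fin n) ℂ :=
  (rxPower h Q)⁻¹ • vecMulVec (Q *ᵥ star h) (star (Q *ᵥ star h))

variable {h : Fin n → ℂ} {Q : Matrix (Fin n) (Fin n) ℂ}

lemma rank_beam_le : (beam h Q).rank ≤ 1 := by
  rw [beam, ← smul_vecMulVec]
  exact rank_vecMulVec_le _ _

lemma posSemidef_beam (hQ : Q.PosSemidef) : (beam h Q).PosSemidef :=
  (posSemidef_vecMulVec_self_star _).smul (inv_nonneg.2 (rxPower_nonneg h hQ))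

/-- Completing the square: the form of `Q - beam h Q` at `x` is the form of `Q` at `x` minus its
`Q`-orthogonal projection onto `hᴴ`. -/
lemma posSemidef_sub_beam (hQ : Q.PosSemidef) (hc : 0 < rxPower h Q) :
    (Q - beam h Q).PosSemidef := by
  refine PosSemidef.of_dotProduct_mulVec_nonneg (hQ.isHermitian.sub (posSemidef_beam hQ).isHermitian)
    fun x => ?_
  set c := rxPower h Q with hcdef
  set z : ℂ := star (Q *ᵥ star h) ⬝ᵥ x with hz
  have hcz : star x ⬝ᵥ (Q *ᵥ star h) = star z := by
    rw [hz, star_dotProduct]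
  have hzh : h ⬝ᵥ (Q *ᵥ x) = z := by
    rw [hz, star_mulVec, hQ.isHermitian.eq, star_star, dotProduct_mulVec]
  have hcc : h ⬝ᵥ (Q *ᵥ star h) = (c : ℂ) := (ofReal_rxPower h hQ).symm
  have hc0 : (c : ℂ) ≠ 0 := by exact_mod_cast hc.ne'
  have key := hQ.dotProduct_mulVec_nonneg (x - ((c : ℂ)⁻¹ * z) • star h)
  have e : star (x - ((c : ℂ)⁻¹ * z) • star h) ⬝ᵥ (Q *ᵥ (x - ((c : ℂ)⁻¹ * z) • star h))
      = star x ⬝ᵥ ((Q - beam h Q) *ᵥ x) := by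
    have hb : beam h Q *ᵥ x = ((c : ℂ)⁻¹ * z) • (Q *ᵥ star h) := by
      rw [beam, smul_mulVec, vecMulVec_mulVec, ← hz, ← hcdef]
      ext i
      simp [mul_comm, mul_left_comm]
    rw [sub_mulVec, hb]
    simp only [star_sub, star_smul, star_star, mulVec_sub, mulVec_smul, sub_dotProduct,
      dotProduct_sub, smul_dotProduct, dotProduct_smul, hcz, hzh, hcc, smul_eq_mul]
    simp only [star_mul', star_inv₀, Complex.star_def, Complex.conj_ofReal]
    field_simp
    ring
  rwa [e] at key

lemma rxPower_beam_self (hQ : Q.PosSemidef) (hc : 0 < rxPower h Q) :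
    rxPower h (beam h Q) = rxPower h Q := by
  have hcc := (ofReal_rxPower h hQ)
  have h2 : star (Q *ᵥ star h) ⬝ᵥ star h = (rxPower h Q : ℂ) := by
    rw [star_dotProduct_star, ← hcc]
    simp
  rw [beam, rxPower_smul]
  have h3 : rxPower h (vecMulVec (Q *ᵥ star h) (star (Q *ᵥ star h))) =
      rxPower h Q * rxPower h Q := by
    conv_lhs => rw [rxPower, vecMulVec_mulVec, h2]
    rw [dotProduct_smul, ← hcc]
    simp
  rw [h3, inv_mul_cancel_left₀ hc.ne']

/-- Nonnegative 2×2 principal minors give `|Q i j|² ≤ Q i i * Q j j`. -/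
lemma norm_entry_le_trace (hQ : Q.PosSemidef) (i j : Fin n) : ‖Q i j‖ ≤ Q.trace.re := by
  have hd : ∀ k, 0 ≤ (Q k k).re ∧ (Q k k).im = 0 := fun k => by
    have := hQ.diag_nonneg (i := k)
    rw [Complex.le_def] at this
    exact ⟨this.1, this.2.symm⟩
  have hle : ∀ k, (Q k k).re ≤ Q.trace.re := fun k => by
    rw [trace, Complex.re_sum]
    exact Finset.single_le_sum (f := fun k => (Q k k).re) (fun k _ => (hd k).1) (Finset.mem_univ k)
  have hdet := (hQ.submatrix ![i, j]).det_nonneg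
  have hs : Q j i = star (Q i j) := (hQ.isHermitian.apply j i).symm
  rw [det_fin_two] at hdet
  simp only [submatrix_apply, cons_val_zero, cons_val_one, hs, Complex.star_def,
    Complex.mul_conj] at hdet
  have h1 := (Complex.le_def.1 hdet).1
  simp only [Complex.zero_re, Complex.sub_re, Complex.mul_re, (hd i).2, (hd j).2,
    Complex.ofReal_re, Complex.normSq_eq_norm_sq] at h1
  have h2 : (Q i i).re * (Q j j).re ≤ Q.trace.re * Q.trace.re :=
    mul_le_mul (hle i) (hle j) (hd j).1 ((hd i).1.trans (hle i))
  exact abs_le_of_sq_le_sq' (by nlinarith) ((hd i).1.trans (hle i)) |>.2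

lemma trace_re_nonneg (hQ : Q.PosSemidef) : 0 ≤ Q.trace.re :=
  (Complex.le_def.1 hQ.trace_nonneg).1

lemma trace_re_pos (hQ : Q.PosSemidef) (h0 : Q ≠ 0) : 0 < Q.trace.re := by
  refine (trace_re_nonneg hQ).lt_of_ne fun h => h0 (hQ.trace_eq_zero_iff.1 ?_)
  exact Complex.ext h.symm (Complex.le_def.1 hQ.trace_nonneg).2.symm

lemma isClosed_setOf_posSemidef : IsClosed {A : Matrix (Fin n) (Fin n) ℂ | A.PosSemidef} := by
  simp only [posSemidef_iff_dotProduct_mulVec, IsHermitian, Set.ofPred_and, Set.ofPred_forall]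
  refine (isClosed_eq (by fun_prop) continuous_id).inter (isClosed_iInter fun x => ?_)
  exact isClosed_le continuous_const (by fun_prop)

lemma isCompact_posSemidef_trace_le (P : ℝ) :
    IsCompact {A : Matrix (Fin n) (Fin n) ℂ | A.PosSemidef ∧ A.trace.re ≤ P} := by
  have hK : IsCompact (Set.pi Set.univ fun _ : Fin n => Set.pi Set.univ fun _ : Fin n =>
      Metric.closedBall (0 : ℂ) P) :=
    isCompact_univ_pi fun _ => isCompact_univ_pi fun _ => isCompact_closedBall 0 P
  refine hK.of_isClosed_subset ?_ ?_
  · exact isClosed_setOf_posSemidef.inter (isClosed_le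
      (Complex.continuous_re.comp continuous_id.matrix_trace) continuous_const)
  · rintro A ⟨hA, hP⟩ i - j -
    simpa using (norm_entry_le_trace hA i j).trans hP

end Matrices

/-! ### Existence and structure of optimal designs -/

section Problem

variable {K Nt : ℕ} [NeZero K] {h : Fin K → Fin Nt → ℂ} {P τms : ℝ}

/-- This polynomial form is visibly closed, and homogeneous in the pair `(c, α - 1)`. -/
lemma eavesdropper_iff {a c α : ℝ} (ha : 0 ≤ a) (hc : 0 ≤ c) (hα : 1 ≤ α) :
    Real.logb 2 (1 + c / (1 + a)) ≤ Real.logb 2 α ↔ c ≤ (α - 1) * (1 + a) := by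
  rw [Real.logb_le_logb one_lt_two (by positivity) (by linarith), ← le_sub_iff_add_le',
    div_le_iff₀ (by linarith)]

lemma ratio_pos {x : Design Nt} (hx : IsFeasible h P τms x) :
    0 < (1 + rxPower (h 0) (x.Qc + x.Qa)) / (x.α * (1 + rxPower (h 0) x.Qa)) := by
  have h1 := rxPower_nonneg (h 0) hx.posSemidef_Qa
  have h2 := rxPower_nonneg (h 0) (hx.posSemidef_Qc.add hx.posSemidef_Qa)
  have h3 := hx.one_le_alpha
  positivity

lemma objective_pos_iff {x : Design Nt} (hx : IsFeasible h P τms x) :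
    0 < objective h x ↔
      (x.α - 1) * (1 + rxPower (h 0) x.Qa) < rxPower (h 0) x.Qc := by
  have h1 := rxPower_nonneg (h 0) hx.posSemidef_Qa
  have h3 := hx.one_le_alpha
  rw [objective, Real.logb_pos_iff one_lt_two (ratio_pos hx), one_lt_div (by positivity),
    rxPower_add]
  constructor <;> intro _ <;> linarith

lemma trace_parts_le {x : Design Nt} (hx : IsFeasible h P τms x) :
    x.Q0.trace.re ≤ P ∧ x.Qa.trace.re ≤ P ∧ x.Qc.trace.re ≤ P := by
  have h0 := trace_re_nonneg hx.posSemidef_Q0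
  have h1 := trace_re_nonneg hx.posSemidef_Qa
  have h2 := trace_re_nonneg hx.posSemidef_Qc
  have h3 := hx.power
  simp only [trace_add, Complex.add_re] at h3
  exact ⟨by linarith, by linarith, by linarith⟩

/-- The feasible set with `α ≤ B`, in coordinates `(Q0, Qa, Qc, α)`. -/
def boundedFeasible (h : Fin K → Fin Nt → ℂ) (P τms B : ℝ) :
    Set (Matrix (Fin Nt) (Fin Nt) ℂ × Matrix (Fin Nt) (Fin Nt) ℂ ×
      Matrix (Fin Nt) (Fin Nt) ℂ × ℝ) :=
  {p | IsFeasible h P τms ⟨p.1, p.2.1, p.2.2.1, p.2.2.2⟩ ∧ p.2.2.2 ≤ B}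

lemma isCompact_boundedFeasible (B : ℝ) : IsCompact (boundedFeasible h P τms B) := by
  have hC := isCompact_posSemidef_trace_le (n := Nt) P
  have hprod := hC.prod (hC.prod (hC.prod (isCompact_Icc (a := (1 : ℝ)) (b := B))))
  have hE : IsClosed {p : Matrix (Fin Nt) (Fin Nt) ℂ × Matrix (Fin Nt) (Fin Nt) ℂ ×
      Matrix (Fin Nt) (Fin Nt) ℂ × ℝ |
      (∀ k : Fin K, k ≠ 0 →
        rxPower (h k) p.2.2.1 ≤ (p.2.2.2 - 1) * (1 + rxPower (h k) p.2.1)) ∧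
      (∀ k : Fin K, 0 ≤ rxPower (h k) p.1 - tauPrime τms * rxPower (h k) (p.2.1 + p.2.2.1)
        - tauPrime τms) ∧
      (p.1 + p.2.1 + p.2.2.1).trace.re ≤ P} := by
    have hr := fun k => continuous_rxPower (h k)
    simp only [Set.ofPred_and, Set.ofPred_forall]
    refine IsClosed.inter ?_ (IsClosed.inter ?_ ?_)
    · exact isClosed_iInter fun k => isClosed_iInter fun _ =>
        isClosed_le (by fun_prop) (by fun_prop)
    · exact isClosed_iInter fun k => isClosed_le (by fun_prop) (by fun_prop)
    · exact isClosed_le (by fun_prop) (by fun_prop)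
  convert hprod.inter_right hE using 1
  ext ⟨Q0, Qa, Qc, α⟩
  constructor
  · rintro ⟨hx, hB⟩
    obtain ⟨t0, ta, tc⟩ := trace_parts_le hx
    exact ⟨⟨⟨hx.posSemidef_Q0, t0⟩, ⟨hx.posSemidef_Qa, ta⟩, ⟨hx.posSemidef_Qc, tc⟩,
      hx.one_le_alpha, hB⟩, fun k hk => (eavesdropper_iff (rxPower_nonneg _ hx.posSemidef_Qa)
        (rxPower_nonneg _ hx.posSemidef_Qc) hx.one_le_alpha).1 (hx.eavesdropper k hk),
      hx.multicast, hx.power⟩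
  · rintro ⟨⟨⟨h0, -⟩, ⟨ha, -⟩, ⟨hc, -⟩, hα, hB⟩, he, hm, hp⟩
    exact ⟨⟨hα, fun k hk => (eavesdropper_iff (rxPower_nonneg _ ha) (rxPower_nonneg _ hc) hα).2
      (he k hk), hm, hp, h0, ha, hc⟩, hB⟩

lemma exists_isOptimal (hpos : ∃ y : Design Nt, IsFeasible h P τms y ∧ 0 < objective h y) :
    ∃ x : Design Nt, IsOptimal h P τms x := by
  obtain ⟨y, hy, hy0⟩ := hpos
  obtain ⟨C, hC⟩ := (isCompact_posSemidef_trace_le (n := Nt) P).bddAbove_image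
    (continuous_rxPower (h 0)).continuousOn
  have hbound : ∀ z : Design Nt, IsFeasible h P τms z → 0 < objective h z → z.α ≤ 1 + C := by
    intro z hz hz0
    have h1 := (objective_pos_iff hz).1 hz0
    have h2 : rxPower (h 0) z.Qc ≤ C := hC ⟨z.Qc, ⟨hz.posSemidef_Qc, (trace_parts_le hz).2.2⟩, rfl⟩
    have h3 := mul_nonneg (sub_nonneg.2 hz.one_le_alpha) (rxPower_nonneg (h 0) hz.posSemidef_Qa)
    linarith
  have hcont : ContinuousOn (fun p : Matrix (Fin Nt) (Fin Nt) ℂ × Matrix (Fin Nt) (Fin Nt) ℂ ×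
      Matrix (Fin Nt) (Fin Nt) ℂ × ℝ => objective h ⟨p.1, p.2.1, p.2.2.1, p.2.2.2⟩)
      (boundedFeasible h P τms (1 + C)) := by
    have hr := continuous_rxPower (h 0)
    unfold objective Real.logb
    refine ContinuousOn.div_const (ContinuousOn.log (ContinuousOn.div ?_ ?_ ?_) ?_) _
    · exact Continuous.continuousOn (by fun_prop)
    · exact Continuous.continuousOn (by fun_prop)
    · exact fun p hp => (div_ne_zero_iff.1 (ratio_pos hp.1).ne').2
    · exact fun p hp => (ratio_pos hp.1).ne'
  obtain ⟨p, hp, hmax⟩ := (isCompact_boundedFeasible (1 + C)).exists_isMaxOn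
    ⟨(y.Q0, y.Qa, y.Qc, y.α), hy, hbound y hy hy0⟩ hcont
  refine ⟨⟨p.1, p.2.1, p.2.2.1, p.2.2.2⟩, hp.1, fun z hz => ?_⟩
  -- Points with larger `α` have nonpositive objective, so `y` beats them.
  by_cases hz0 : 0 < objective h z
  · exact hmax (a := (z.Q0, z.Qa, z.Qc, z.α)) ⟨hz, hbound z hz hz0⟩
  · exact (not_lt.1 hz0).trans (hy0.le.trans
      (hmax (a := (y.Q0, y.Qa, y.Qc, y.α)) ⟨hy, hbound y hy hy0⟩))

/-- A design with positive objective that leaves power unused can be improved strictly, by scaling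
the two message covariances up. -/
lemma exists_objective_lt_of_power_lt (hτ : 0 ≤ τms) {x : Design Nt}
    (hx : IsFeasible h P τms x) (hpos : 0 < objective h x)
    (hslack : (x.Q0 + x.Qa + x.Qc).trace.re < P) :
    ∃ y : Design Nt, IsFeasible h P τms y ∧ objective h x < objective h y := by
  have hτ' : 0 ≤ tauPrime τms := sub_nonneg.2 (Real.one_le_rpow one_le_two hτ)
  have hα := hx.one_le_alpha
  have t0 := trace_re_nonneg hx.posSemidef_Q0
  have tc := trace_re_nonneg hx.posSemidef_Qc
  simp only [trace_add, Complex.add_re] at hslack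
  obtain ⟨ε, hε, hεP⟩ : ∃ ε : ℝ, 0 < ε ∧ ε * (x.Q0.trace.re + x.Qc.trace.re) ≤
      P - (x.Q0.trace.re + x.Qa.trace.re + x.Qc.trace.re) := by
    -- The `+ 1` keeps the denominator positive without further argument.
    refine ⟨(P - (x.Q0.trace.re + x.Qa.trace.re + x.Qc.trace.re)) /
      (x.Q0.trace.re + x.Qc.trace.re + 1), div_pos (by linarith) (by linarith), ?_⟩
    rw [div_mul_eq_mul_div, div_le_iff₀ (by linarith)]
    exact mul_le_mul_of_nonneg_left (by linarith) (by linarith)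
  have hε0 : 0 ≤ 1 + ε := by linarith
  have hα' : 1 ≤ 1 + (1 + ε) * (x.α - 1) := by
    have := mul_nonneg hε0 (sub_nonneg.2 hα)
    linarith
  -- Scaling `α - 1` along with `Qc` preserves the eavesdropper constraints; the noise stays fixed.
  have hy : IsFeasible h P τms
      ⟨(1 + ε) • x.Q0, x.Qa, (1 + ε) • x.Qc, 1 + (1 + ε) * (x.α - 1)⟩ := by
    refine ⟨hα', fun k hk => ?_, fun k => ?_, ?_, hx.posSemidef_Q0.smul hε0, hx.posSemidef_Qa,
      hx.posSemidef_Qc.smul hε0⟩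
    · have ha := rxPower_nonneg (h k) hx.posSemidef_Qa
      have hc := rxPower_nonneg (h k) hx.posSemidef_Qc
      have := (eavesdropper_iff ha hc hα).1 (hx.eavesdropper k hk)
      simp only [rxPower_smul]
      rw [eavesdropper_iff ha (by positivity) hα', add_sub_cancel_left, mul_assoc]
      exact mul_le_mul_of_nonneg_left this hε0
    · have ha := rxPower_nonneg (h k) hx.posSemidef_Qa
      have hm := mul_nonneg hε0 (hx.multicast k)
      -- The new multicast margin is `1 + ε` times the old one plus this term.
      have hn : 0 ≤ ε * tauPrime τms * (1 + rxPower (h k) x.Qa) := by positivity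
      simp only [rxPower_add, rxPower_smul] at hm ⊢
      linarith
    · simp only [trace_add, trace_smul, Complex.add_re, Complex.smul_re, smul_eq_mul]
      linarith
  refine ⟨_, hy, Real.logb_lt_logb one_lt_two (ratio_pos hx) ?_⟩
  have ha := rxPower_nonneg (h 0) hx.posSemidef_Qa
  -- After cross-multiplication, the two sides differ by exactly this quantity.
  have hgap := mul_pos hε (sub_pos.2 ((objective_pos_iff hx).1 hpos))
  simp only [rxPower_add, rxPower_smul]
  rw [← div_div, ← div_div]
  refine div_lt_div_of_pos_right ?_ (by linarith)
  rw [div_lt_div_iff₀ (by linarith) (by linarith)]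
  linarith

/-- Replacing the confidential covariance by `beam (h 0) Qc` keeps feasibility and the objective. -/
lemma IsFeasible.beam {x : Design Nt} (hx : IsFeasible h P τms x) (hτ : 0 ≤ τms)
    (hc : 0 < rxPower (h 0) x.Qc) :
    IsFeasible h P τms ⟨x.Q0, x.Qa, SecrecyRate.beam (h 0) x.Qc, x.α⟩ := by
  have hτ' : 0 ≤ tauPrime τms := sub_nonneg.2 (Real.one_le_rpow one_le_two hτ)
  have hR := posSemidef_sub_beam hx.posSemidef_Qc hc
  have hB := posSemidef_beam (h := h 0) hx.posSemidef_Qc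
  have hle : ∀ k, rxPower (h k) (SecrecyRate.beam (h 0) x.Qc) ≤ rxPower (h k) x.Qc := fun k => by
    have := rxPower_nonneg (h k) hR
    rw [rxPower_sub] at this
    linarith
  refine ⟨hx.one_le_alpha, fun k hk => ?_, fun k => ?_, ?_, hx.posSemidef_Q0, hx.posSemidef_Qa, hB⟩
  · have ha := rxPower_nonneg (h k) hx.posSemidef_Qa
    exact (eavesdropper_iff ha (rxPower_nonneg _ hB) hx.one_le_alpha).2 ((hle k).trans
      ((eavesdropper_iff ha (rxPower_nonneg _ hx.posSemidef_Qc) hx.one_le_alpha).1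
        (hx.eavesdropper k hk)))
  · have hm := hx.multicast k
    have := mul_le_mul_of_nonneg_left (hle k) hτ'
    simp only [rxPower_add] at hm ⊢
    linarith
  · have hp := hx.power
    have := trace_re_nonneg hR
    simp only [trace_add, trace_sub, Complex.add_re, Complex.sub_re] at hp this ⊢
    linarith

lemma IsOptimal.rank_eq_one {x : Design Nt} (hx : IsOptimal h P τms x) (hτ : 0 ≤ τms)
    (hpos : 0 < objective h x) : x.Qc.rank = 1 := by
  have hα := hx.1.one_le_alpha
  have ha := rxPower_nonneg (h 0) hx.1.posSemidef_Qa
  have hc : 0 < rxPower (h 0) x.Qc :=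
    (mul_nonneg (by linarith) (by linarith)).trans_lt ((objective_pos_iff hx.1).1 hpos)
  have hbeam : x.Qc = SecrecyRate.beam (h 0) x.Qc := by
    by_contra hne
    have hfeas := hx.1.beam hτ hc
    have hobj : objective h ⟨x.Q0, x.Qa, SecrecyRate.beam (h 0) x.Qc, x.α⟩ = objective h x := by
      simp only [objective, rxPower_add, rxPower_beam_self hx.1.posSemidef_Qc hc]
    have htr := trace_re_pos (posSemidef_sub_beam hx.1.posSemidef_Qc hc) (sub_ne_zero.2 hne)
    have hp := hx.1.power
    obtain ⟨y, hy, hlt⟩ := exists_objective_lt_of_power_lt hτ hfeas (hobj ▸ hpos) (by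
      simp only [trace_add, trace_sub, Complex.add_re, Complex.sub_re] at hp htr ⊢
      linarith)
    exact (hx.2 y hy).not_gt (hobj ▸ hlt)
  refine le_antisymm (hbeam ▸ rank_beam_le) (Nat.one_le_iff_ne_zero.2 fun h0 => ?_)
  rw [Matrix.rank, Submodule.finrank_eq_zero, LinearMap.range_eq_bot] at h0
  have hv : x.Qc *ᵥ star (h 0) = 0 := congrArg (fun f => f (star (h 0))) h0
  simp [rxPower, hv] at hc

end Problem

end SecrecyRate

theorem proposition1 {K Nt : ℕ} [NeZero K] (h : Fin K → Fin Nt → ℂ) (P τms : ℝ)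
    (hτ : 0 ≤ τms)
    (hpos : ∃ y : SecrecyRate.Design Nt,
      SecrecyRate.IsFeasible h P τms y ∧ 0 < SecrecyRate.objective h y) :
    (∃ x : SecrecyRate.Design Nt, SecrecyRate.IsOptimal h P τms x) ∧
      ∀ x : SecrecyRate.Design Nt, SecrecyRate.IsOptimal h P τms x → x.Qc.rank = 1 := by
  refine ⟨SecrecyRate.exists_isOptimal hpos, fun x hx => ?_⟩
  obtain ⟨y, hy, hy0⟩ := hpos
  exact hx.rank_eq_one hτ (hy0.trans_le (hx.2 y hy))
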